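/- Let $(A,M)$ be a local domain (not assumed Noetherian) whose maximal ideal $M$ is not finitely generated, let $f:A\to B$ be a homomorphism of commutative rings with identity, and let $J$ be an ideal of $B$ with $0\neq J\neq B$ such that $J$ is finitely generated as an ideal of the subring $f(A)+J$ of $B$, $f(M)J=0$ and $J^2=0$. Let $A\bowtie^f J=\{(a,f(a)+j) : a\in A,\ j\in J\}$, a subring of $A\times B$. For a commutative ring $R$ and an integer $n\ge 0$, an $R$-module $E$ is called $n$-presented if there is an exact sequence $F_n\to F_{n-1}\to\dots\to F_0\to E\to 0$ of $R$-modules in which each $F_i$ is free and finitely generated. For integers $n,d\ge 0$, $R$ is called an $(n,d)$-ring if every $n$-presented $R$-module has projective dimension at most $d$. Then: 1. $A\bowtie^f J$ is a $(3,0)$-ring which is not a $(2,0)$-ring. 2. For every integer $d\ge 0$ and every Noetherian commutative ring $A_2$ of global dimension $d$, the product $(A\bowtie^f J)\times A_2$ is a $(3,d)$-ring which is not a $(2,d)$-ring and, if $d\ge 1$, is not a $(3,d-1)$-ring. -/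

import Mathlib

universe u v w

/-- The amalgamation of `A` with `B` along the ideal `J` with respect to `f`: the subring
`{(a, f a + j) | a ∈ A, j ∈ J}` of `A × B`. -/
def amalgamation {A : Type u} {B : Type v} [CommRing A] [CommRing B]
    (f : A →+* B) (J : Ideal B) : Subring (A × B) where
  carrier := {x | ∃ a : A, ∃ j ∈ J, x = (a, f a + j)}
  mul_mem' := by
    rintro _ _ ⟨a, j, hj, rfl⟩ ⟨b, k, hk, rfl⟩
    refine ⟨a * b, f a * k + f b * j + j * k,
      J.add_mem (J.add_mem (J.mul_mem_left _ hk) (J.mul_mem_left _ hj)) (J.mul_mem_left _ hk), ?_⟩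
    ext
    · rfl
    · simp only [Prod.mk_mul_mk, map_mul]
      ring
  one_mem' := ⟨1, 0, J.zero_mem, by simp only [map_one, add_zero, Prod.mk_one_one]⟩
  add_mem' := by
    rintro _ _ ⟨a, j, hj, rfl⟩ ⟨b, k, hk, rfl⟩
    refine ⟨a + b, j + k, J.add_mem hj hk, ?_⟩
    ext
    · rfl
    · simp only [Prod.mk_add_mk, map_add]
      ring
  zero_mem' := ⟨0, 0, J.zero_mem, by simp only [map_zero, add_zero, Prod.mk_zero_zero]⟩
  neg_mem' := by
    rintro _ ⟨a, j, hj, rfl⟩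
    refine ⟨-a, -j, J.neg_mem hj, ?_⟩
    ext
    · rfl
    · simp only [Prod.neg_mk, map_neg]
      ring

/-- The subring `f(A) + J` of `B`. -/
def rangeAddIdeal {A : Type u} {B : Type v} [CommRing A] [CommRing B]
    (f : A →+* B) (J : Ideal B) : Subring B where
  carrier := {b | ∃ a : A, ∃ j ∈ J, b = f a + j}
  mul_mem' := by
    rintro _ _ ⟨a, j, hj, rfl⟩ ⟨b, k, hk, rfl⟩
    refine ⟨a * b, f a * k + f b * j + j * k,
      J.add_mem (J.add_mem (J.mul_mem_left _ hk) (J.mul_mem_left _ hj)) (J.mul_mem_left _ hk), ?_⟩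
    rw [map_mul]
    ring
  one_mem' := ⟨1, 0, J.zero_mem, by simp only [map_one, add_zero]⟩
  add_mem' := by
    rintro _ _ ⟨a, j, hj, rfl⟩ ⟨b, k, hk, rfl⟩
    refine ⟨a + b, j + k, J.add_mem hj hk, ?_⟩
    rw [map_add]
    ring
  zero_mem' := ⟨0, 0, J.zero_mem, by simp only [map_zero, add_zero]⟩
  neg_mem' := by
    rintro _ ⟨a, j, hj, rfl⟩
    refine ⟨-a, -j, J.neg_mem hj, ?_⟩
    rw [map_neg]
    ring

/-- `J` regarded as an ideal of the subring `f(A) + J ⊆ B`. -/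
def idealInRangeAdd {A : Type u} {B : Type v} [CommRing A] [CommRing B]
    (f : A →+* B) (J : Ideal B) : Ideal (rangeAddIdeal f J) :=
  J.comap (rangeAddIdeal f J).subtype

/-- `E` is `n`-presented: there is an exact sequence `F_n → ⋯ → F_1 → F_0 → E → 0` in which
`F_i = R ^ (r i)` is finitely generated and free. Here `δ i : F_(i+1) → F_i` and `ε : F_0 → E`.
The data `r i` with `i > n`, and `δ i` with `i ≥ n`, are not constrained and carry no information. -/
def IsNPresented (R : Type u) [CommRing R] (n : ℕ) (E : Type v) [AddCommGroup E] [Module R E] :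
    Prop :=
  ∃ (r : ℕ → ℕ) (δ : ∀ i : ℕ, (Fin (r (i + 1)) → R) →ₗ[R] (Fin (r i) → R))
    (ε : (Fin (r 0) → R) →ₗ[R] E),
    Function.Surjective ε ∧
    (1 ≤ n → Function.Exact (δ 0) ε) ∧
    ∀ i : ℕ, i + 2 ≤ n → Function.Exact (δ (i + 1)) (δ i)

/-- `R` is an `(n, d)`-ring: every `n`-presented `R`-module has projective dimension at most `d`.
Such modules are finitely generated, so those in the universe of `R` represent all of them up to
isomorphism. -/
def IsNDRing (R : Type u) [CommRing R] (n d : ℕ) : Prop :=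
  ∀ E : ModuleCat.{u} R, IsNPresented R n E →
    CategoryTheory.projectiveDimension E ≤ (d : WithBot ℕ∞)

/-- The global dimension of `R`: the supremum of the projective dimensions of all `R`-modules. -/
noncomputable def globalDim (R : Type u) [CommRing R] : WithBot ℕ∞ :=
  ⨆ E : ModuleCat.{u} R, CategoryTheory.projectiveDimension E

/-! Write R for the amalgamation. Since J² = 0, R is local with maximal ideal 𝔪 the preimage of M,
and 𝔪 is not finitely generated because it maps onto M. For 0 ≠ j ∈ J the element y = (0, j) is
killed by 𝔪, as f(M)J = 0 and J² = 0, but lies outside 𝔪², whose elements (a, b) all satisfy b = f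
a. Hence whenever y lies in a module N of vectors or scalars from 𝔪, it escapes 𝔪N, and k = R/𝔪 is a
direct summand of N.

(3,0): take two minimal free covers over a 3-presented E. If the second cover is nonzero, its kernel
is finitely presented and has k as a summand, so 𝔪 would be finitely generated. Thus the first
syzygy vanishes and E is free (`IsLocalRing.projective_of_isNPresented_three`).

Not (2,d): for 0 ≠ a ∈ M and x = (a, f a), the annihilator of x is 0 × J, which is finitely
generated, so R/(x) is 2-presented. Its second syzygy has k as a summand. Moreover k is a summand of
its own first syzygy 𝔪 and is not projective, so its projective dimension is infinite
(`not_isNDRing_two`).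

Products: modules split into their two components. The A₂ component contributes exactly the global
dimension, attained on cyclic modules by Auslander's theorem; these are n-presented for all n since
A₂ is Noetherian. -/

/-! ### n-presented modules and Schanuel's lemma. -/

section NPresented

variable {R : Type u} [CommRing R]

theorem Function.Exact.nonempty_equiv_prod_of_projective {K M P : Type*} [AddCommGroup K]
    [AddCommGroup M] [AddCommGroup P] [Module R K] [Module R M] [Module R P]
    [Module.Projective R P] {i : K →ₗ[R] M} {g : M →ₗ[R] P} (h : Function.Exact i g)
    (hi : Function.Injective i) (hg : Function.Surjective g) : Nonempty (M ≃ₗ[R] K × P) :=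
  let ⟨s, hs⟩ := g.exists_rightInverse_of_surjective (LinearMap.range_eq_top.2 hg)
  ⟨(h.splitSurjectiveEquiv hi ⟨s, hs⟩).1⟩

/-- In a left exact sequence, the first module is the kernel of the second map. -/
noncomputable def Function.Exact.equivKer {K M P : Type*} [AddCommGroup K] [AddCommGroup M]
    [AddCommGroup P] [Module R K] [Module R M] [Module R P] {i : K →ₗ[R] M} {g : M →ₗ[R] P}
    (h : Function.Exact i g) (hi : Function.Injective i) : K ≃ₗ[R] LinearMap.ker g :=
  (LinearEquiv.ofInjective i hi).trans (LinearEquiv.ofEq _ _ h.linearMap_ker_eq.symm)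

theorem isNPresented_zero_iff {E : Type v} [AddCommGroup E] [Module R E] :
    IsNPresented R 0 E ↔ Module.Finite R E := by
  constructor
  · rintro ⟨r, δ, ε, hε, -⟩
    exact Module.Finite.of_surjective ε hε
  · intro _
    obtain ⟨n, ε, hε⟩ := Module.Finite.exists_fin' R E
    exact ⟨fun _ => n, fun _ => 0, ε, hε, by simp, by simp⟩

/-- Peeling off F₀ turns the definition by resolutions into an induction on syzygies. -/
theorem isNPresented_succ_iff {n : ℕ} {E : Type v} [AddCommGroup E] [Module R E] :
    IsNPresented R (n + 1) E ↔ ∃ (r : ℕ) (ε : (Fin r → R) →ₗ[R] E),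
      Function.Surjective ε ∧ IsNPresented R n (LinearMap.ker ε) := by
  constructor
  · rintro ⟨r, δ, ε, hε, h0, h⟩
    have h0 := h0 (by omega)
    refine ⟨r 0, ε, hε, fun i => r (i + 1), fun i => δ (i + 1),
      (δ 0).codRestrict (LinearMap.ker ε) fun c => (h0 _).2 ⟨c, rfl⟩, ?_, ?_, ?_⟩
    · rintro ⟨c, hc⟩
      obtain ⟨d, rfl⟩ := (h0 c).1 hc
      exact ⟨d, rfl⟩
    · intro hn c
      rw [← h 0 (by omega) c, ← Subtype.coe_inj]
      rfl
    · intro i hi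
      exact h (i + 1) (by omega)
  · rintro ⟨r₀, ε₀, hε₀, r, δ, ε, hε, h0, h⟩
    refine ⟨fun i => Nat.casesOn i r₀ r,
      fun i => Nat.casesOn i ((LinearMap.ker ε₀).subtype ∘ₗ ε) δ, ε₀, hε₀, ?_, ?_⟩
    · intro _ c
      constructor
      · intro hc
        obtain ⟨d, hd⟩ := hε ⟨c, hc⟩
        exact ⟨d, congrArg Subtype.val hd⟩
      · rintro ⟨d, rfl⟩
        exact (ε d).2
    · rintro (_ | i) hi
      · intro c
        rw [← h0 (by omega) c, ← Subtype.coe_inj]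
        rfl
      · exact h i (by omega)

theorem IsNPresented.of_linearEquiv {n : ℕ} {E : Type v} {E' : Type w} [AddCommGroup E]
    [Module R E] [AddCommGroup E'] [Module R E'] (h : IsNPresented R n E) (e : E ≃ₗ[R] E') :
    IsNPresented R n E' := by
  obtain ⟨r, δ, ε, hε, h0, h⟩ := h
  refine ⟨r, δ, e.toLinearMap ∘ₗ ε, e.surjective.comp hε, fun hn c => ?_, h⟩
  rw [← h0 hn c]
  simp

theorem IsNPresented.finite {n : ℕ} {E : Type v} [AddCommGroup E] [Module R E]
    (h : IsNPresented R n E) : Module.Finite R E :=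
  let ⟨_, _, ε, hε, _⟩ := h
  Module.Finite.of_surjective ε hε

/-- Add a free cover of Q to one of N: its kernel is again finitely generated projective because the
cover splits, so induction applies. All modules stay in the universe of R, where the kernels live.
-/
theorem IsNPresented.prod_projective_aux {n : ℕ} {N Q : Type u} [AddCommGroup N] [Module R N]
    [AddCommGroup Q] [Module R Q] [Module.Finite R Q] [Module.Projective R Q]
    (h : IsNPresented R n N) : IsNPresented R n (N × Q) := by
  induction n generalizing N Q with
  | zero =>
    rw [isNPresented_zero_iff] at h ⊢
    infer_instance
  | succ n ih =>
    obtain ⟨t, ε, hε, h⟩ := isNPresented_succ_iff.1 h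
    obtain ⟨k, g, hg⟩ := Module.Finite.exists_fin' R Q
    have hex : Function.Exact (LinearMap.ker g).subtype g := LinearMap.exact_subtype_ker_map g
    obtain ⟨e⟩ := hex.nonempty_equiv_prod_of_projective Subtype.val_injective hg
    have hfin : Module.Finite R (LinearMap.ker g) :=
      Module.Finite.of_surjective (LinearMap.fst R _ _ ∘ₗ e.toLinearMap)
        (Prod.fst_surjective.comp e.surjective)
    have hproj : Module.Projective R (LinearMap.ker g) :=
      Module.Projective.of_split (e.symm.toLinearMap ∘ₗ LinearMap.inl R _ _)
        (LinearMap.fst R _ _ ∘ₗ e.toLinearMap) (by ext; simp)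
    let e' : (Fin (t + k) → R) ≃ₗ[R] (Fin t → R) × (Fin k → R) :=
      (LinearEquiv.funCongrLeft R R finSumFinEquiv).trans
        (LinearEquiv.sumArrowLequivProdArrow (Fin t) (Fin k) R R)
    refine isNPresented_succ_iff.2 ⟨t + k, ε.prodMap g ∘ₗ e'.toLinearMap,
      (Prod.map_surjective.2 ⟨hε, hg⟩).comp e'.surjective, ?_⟩
    refine (ih (N := LinearMap.ker ε) (Q := LinearMap.ker g) h).of_linearEquiv
      (Function.Exact.equivKer (i := e'.symm.toLinearMap ∘ₗ
        (LinearMap.ker ε).subtype.prodMap (LinearMap.ker g).subtype) (fun c => ?_) ?_)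
    · obtain ⟨⟨a, b⟩, rfl⟩ := e'.symm.surjective c
      simp only [LinearMap.comp_apply, LinearEquiv.coe_coe, LinearMap.prodMap_apply,
        Prod.mk_eq_zero, Set.mem_range, EmbeddingLike.apply_eq_iff_eq,
        LinearEquiv.apply_symm_apply]
      constructor
      · rintro ⟨h₁, h₂⟩
        exact ⟨(⟨_, h₁⟩, ⟨_, h₂⟩), rfl⟩
      · rintro ⟨⟨⟨x, hx⟩, ⟨y, hy⟩⟩, h⟩
        obtain ⟨rfl, rfl⟩ := Prod.mk.inj h
        exact ⟨hx, hy⟩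
    · exact e'.symm.injective.comp
        (Prod.map_injective.2 ⟨Subtype.val_injective, Subtype.val_injective⟩)

theorem IsNPresented.prod_projective {n : ℕ} {N : Type v} {Q : Type w} [AddCommGroup N]
    [Module R N] [AddCommGroup Q] [Module R Q] [Module.Finite R Q] [Module.Projective R Q]
    (h : IsNPresented R n N) : IsNPresented R n (N × Q) := by
  have := h.finite
  have : Small.{u} N := Module.Finite.small.{u} R N
  have : Small.{u} Q := Module.Finite.small.{u} R Q
  have hN := h.of_linearEquiv (Shrink.linearEquiv.{u} R N).symm
  have : Module.Projective R (Shrink.{u} Q) :=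
    Module.Projective.of_equiv (Shrink.linearEquiv.{u} R Q).symm
  have : Module.Finite R (Shrink.{u} Q) := Module.Finite.equiv (Shrink.linearEquiv.{u} R Q).symm
  exact (hN.prod_projective_aux (Q := Shrink.{u} Q)).of_linearEquiv
    ((Shrink.linearEquiv.{u} R N).prodCongr (Shrink.linearEquiv.{u} R Q))

/-- For a free cover of N × Q, the kernel of the composite onto N is the old kernel plus Q, since it
maps onto the projective module Q. -/
theorem IsNPresented.of_prod_projective {n : ℕ} {N : Type v} {Q : Type w} [AddCommGroup N]
    [Module R N] [AddCommGroup Q] [Module R Q] [Module.Finite R Q] [Module.Projective R Q]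
    (h : IsNPresented R n (N × Q)) : IsNPresented R n N := by
  cases n with
  | zero =>
    have := h.finite
    exact isNPresented_zero_iff.2 (Module.Finite.of_surjective (LinearMap.fst R N Q)
      Prod.fst_surjective)
  | succ n =>
    obtain ⟨t, ε, hε, h⟩ := isNPresented_succ_iff.1 h
    let ε₁ : (Fin t → R) →ₗ[R] N := LinearMap.fst R N Q ∘ₗ ε
    refine isNPresented_succ_iff.2 ⟨t, ε₁, Prod.fst_surjective.comp hε, ?_⟩
    have hle : LinearMap.ker ε ≤ LinearMap.ker ε₁ :=
      LinearMap.ker_le_ker_comp ε (LinearMap.fst R N Q)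
    have hex : Function.Exact (Submodule.inclusion hle)
        (LinearMap.snd R N Q ∘ₗ ε ∘ₗ (LinearMap.ker ε₁).subtype) := by
      rintro ⟨c, hc⟩
      constructor
      · intro hc'
        exact ⟨⟨c, Prod.ext hc hc'⟩, rfl⟩
      · rintro ⟨⟨d, hd⟩, hdc⟩
        obtain rfl : d = c := congrArg Subtype.val hdc
        exact congrArg Prod.snd hd
    obtain ⟨e⟩ := hex.nonempty_equiv_prod_of_projective (Submodule.inclusion_injective hle) <| by
      intro q
      obtain ⟨c, hc⟩ := hε (0, q)
      exact ⟨⟨c, congrArg Prod.fst hc⟩, congrArg Prod.snd hc⟩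
    exact h.prod_projective.of_linearEquiv e.symm

/-- A form of Schanuel's lemma. -/
theorem isNPresented_succ_iff_ker {n : ℕ} {E : Type v} {P : Type w} [AddCommGroup E]
    [Module R E] [AddCommGroup P] [Module R P] [Module.Finite R P] [Module.Projective R P]
    (g : P →ₗ[R] E) (hg : Function.Surjective g) :
    IsNPresented R (n + 1) E ↔ IsNPresented R n (LinearMap.ker g) := by
  have key {r : ℕ} (ε : (Fin r → R) →ₗ[R] E) (hε : Function.Surjective ε) :
      IsNPresented R n (LinearMap.ker ε) ↔ IsNPresented R n (LinearMap.ker g) := by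
    -- W is the fibre product of the two covers over E. Both projections split, giving ker ε × P ≃ W
    -- ≃ ker g × Rʳ.
    let W := LinearMap.ker (ε.coprod (-g))
    have hW (c : Fin r → R) (p : P) : (c, p) ∈ W ↔ ε c = g p := by
      simp [W, add_neg_eq_zero]
    let i₁ : LinearMap.ker ε →ₗ[R] W :=
      (LinearMap.inl R _ P ∘ₗ (LinearMap.ker ε).subtype).codRestrict W fun c => by
        rw [LinearMap.comp_apply, LinearMap.inl_apply, hW]
        simp
    let i₂ : LinearMap.ker g →ₗ[R] W :=
      (LinearMap.inr R (Fin r → R) _ ∘ₗ (LinearMap.ker g).subtype).codRestrict W fun c => by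
        rw [LinearMap.comp_apply, LinearMap.inr_apply, hW]
        simp
    have h₁ : Function.Exact i₁ (LinearMap.snd R _ _ ∘ₗ W.subtype) := by
      rintro ⟨⟨c, p⟩, hcp⟩
      constructor
      · rintro (rfl : p = 0)
        exact ⟨⟨c, by simpa using (hW _ _).1 hcp⟩, rfl⟩
      · rintro ⟨d, hd⟩
        exact (congrArg (fun z => z.1.2) hd).symm
    have h₂ : Function.Exact i₂ (LinearMap.fst R _ _ ∘ₗ W.subtype) := by
      rintro ⟨⟨c, p⟩, hcp⟩
      constructor
      · rintro (rfl : c = 0)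
        exact ⟨⟨p, by simpa using ((hW _ _).1 hcp).symm⟩, rfl⟩
      · rintro ⟨d, hd⟩
        exact (congrArg (fun z => z.1.1) hd).symm
    obtain ⟨e₁⟩ := h₁.nonempty_equiv_prod_of_projective
      (fun a b hab => Subtype.ext (congrArg (fun z => z.1.1) hab))
      (fun p => let ⟨c, hc⟩ := hε (g p); ⟨⟨(c, p), (hW c p).2 hc⟩, rfl⟩)
    obtain ⟨e₂⟩ := h₂.nonempty_equiv_prod_of_projective
      (fun a b hab => Subtype.ext (congrArg (fun z => z.1.2) hab))
      (fun c => let ⟨p, hp⟩ := hg (ε c); ⟨⟨(c, p), (hW c p).2 hp.symm⟩, rfl⟩)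
    exact ⟨fun h => (h.prod_projective.of_linearEquiv (e₁.symm.trans e₂)).of_prod_projective,
      fun h => (h.prod_projective.of_linearEquiv (e₂.symm.trans e₁)).of_prod_projective⟩
  rw [isNPresented_succ_iff]
  constructor
  · rintro ⟨r, ε, hε, h⟩
    exact (key ε hε).1 h
  · intro h
    have : Module.Finite R E := Module.Finite.of_surjective g hg
    obtain ⟨r, ε, hε⟩ := Module.Finite.exists_fin' R E
    exact ⟨r, ε, hε, (key ε hε).2 h⟩

theorem IsNPresented.finitePresentation {n : ℕ} {E : Type v} [AddCommGroup E] [Module R E]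
    (h : IsNPresented R (n + 1) E) : Module.FinitePresentation R E := by
  obtain ⟨r, ε, hε, h⟩ := isNPresented_succ_iff.1 h
  have := h.finite
  exact Module.finitePresentation_of_free_of_surjective ε hε (Module.Finite.iff_fg.1 this)

end NPresented

open CategoryTheory

/-! ### Local rings: summands isomorphic to the residue field, and the (3,0) property. -/

section Local

variable {R : Type u} [CommRing R]

/-- A finitely generated module over a local ring has a minimal free cover. -/
theorem IsLocalRing.exists_surjective_forall_mem_maximalIdeal [IsLocalRing R] (E : Type v)
    [AddCommGroup E] [Module R E] [Module.Finite R E] :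
    ∃ (r : ℕ) (ε : (Fin r → R) →ₗ[R] E), Function.Surjective ε ∧
      ∀ c, ε c = 0 → ∀ i, c i ∈ maximalIdeal R := by
  let b := Module.finBasis (ResidueField R) (TensorProduct R (ResidueField R) E)
  choose v hv using fun i => TensorProduct.mk_surjective R E (ResidueField R)
    Ideal.Quotient.mk_surjective (b i)
  refine ⟨_, Fintype.linearCombination R v, ?_, fun c hc i => ?_⟩
  · rw [← LinearMap.range_eq_top, Fintype.range_linearCombination]
    exact IsLocalRing.span_eq_top_of_tmul_eq_basis v b hv
  -- A relation among the lifted generators becomes, after tensoring with the residue field, a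
  -- relation among basis vectors.
  · have h : ∑ i, residue R (c i) • b i = 0 := by
      have := congrArg (TensorProduct.mk R (ResidueField R) E 1) hc
      simp only [Fintype.linearCombination_apply, map_sum, map_smul, hv, map_zero] at this
      rw [← this]
      rfl
    exact (residue_eq_zero_iff _).1 (Fintype.linearIndependent_iff.1 b.linearIndependent _ h i)

/-- An element outside `𝔪 N` that is killed by the maximal ideal `𝔪` spans a direct summand. -/
theorem Ideal.IsMaximal.exists_retract_quotient {𝔪 : Ideal R} (h𝔪 : 𝔪.IsMaximal) {N : Type v}
    [AddCommGroup N] [Module R N] {y : N} (hy : ∀ a ∈ 𝔪, a • y = 0)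
    (hy' : y ∉ 𝔪 • (⊤ : Submodule R N)) :
    ∃ (i : R ⧸ 𝔪 →ₗ[R] N) (φ : N →ₗ[R] R ⧸ 𝔪), φ ∘ₗ i = LinearMap.id := by
  let _ : Field (R ⧸ 𝔪) := Ideal.Quotient.field 𝔪
  -- A functional on the vector space N/𝔪N detects y; rescaled to take the value 1 there, it
  -- retracts 1 ↦ y.
  obtain ⟨f, hf⟩ : ∃ f : Module.Dual (R ⧸ 𝔪) (N ⧸ 𝔪 • (⊤ : Submodule R N)),
      f (Submodule.Quotient.mk y) ≠ 0 := by
    by_contra! h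
    exact hy' ((Submodule.Quotient.mk_eq_zero _).1
      ((Module.forall_dual_apply_eq_zero_iff (R ⧸ 𝔪) _).1 h))
  refine ⟨Submodule.liftQ 𝔪 (LinearMap.toSpanSingleton R N y) fun a ha => hy a ha,
    (((f (Submodule.Quotient.mk y))⁻¹ • f).restrictScalars R) ∘ₗ Submodule.mkQ _, ?_⟩
  refine Submodule.linearMap_qext _ (LinearMap.ext_ring ?_)
  exact (congrArg (fun z => (f (Submodule.Quotient.mk y))⁻¹ * f (Submodule.Quotient.mk z))
    (one_smul R y)).trans (inv_mul_cancel₀ hf)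

theorem Ideal.fg_of_finitePresentation_quotient {I : Ideal R}
    (h : Module.FinitePresentation R (R ⧸ I)) : I.FG := by
  have := Module.FinitePresentation.fg_ker I.mkQ I.mkQ_surjective
  rwa [Submodule.ker_mkQ] at this

theorem Module.FinitePresentation.of_retract {M N : Type*} [AddCommGroup M] [Module R M]
    [AddCommGroup N] [Module R N] [Module.FinitePresentation R N] {i : M →ₗ[R] N}
    {φ : N →ₗ[R] M} (h : φ ∘ₗ i = LinearMap.id) : Module.FinitePresentation R M := by
  have h' (m : M) : φ (i m) = m := LinearMap.congr_fun h m
  refine Module.finitePresentation_of_surjective φ (fun m => ⟨i m, h' m⟩) ?_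
  have : LinearMap.ker φ = LinearMap.range (LinearMap.id - i ∘ₗ φ) := by
    ext n
    constructor
    · intro hn
      exact ⟨n, by simp [LinearMap.mem_ker.1 hn]⟩
    · rintro ⟨n, rfl⟩
      simp [h']
  rw [this, LinearMap.range_eq_map]
  exact Module.Finite.fg_top.map _

/-- Three presentation steps leave the second minimal syzygy finitely presented, which is
incompatible with having R/𝔪 as a summand when 𝔪 is not finitely generated. -/
theorem IsLocalRing.projective_of_isNPresented_three [IsLocalRing R]
    (hm : ¬ (maximalIdeal R).FG) {y : R} (hy : ∀ a ∈ maximalIdeal R, a * y = 0)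
    (hy' : y ∉ maximalIdeal R ^ 2) {E : Type v} [AddCommGroup E] [Module R E]
    (hE : IsNPresented R 3 E) : Module.Projective R E := by
  have := hE.finite
  obtain ⟨r, ε, hε, hεm⟩ := exists_surjective_forall_mem_maximalIdeal (R := R) E
  have h₀ := (isNPresented_succ_iff_ker ε hε).1 hE
  have := h₀.finite
  obtain ⟨s, δ, hδ, hδm⟩ :=
    exists_surjective_forall_mem_maximalIdeal (R := R) (LinearMap.ker ε)
  have h₁ := ((isNPresented_succ_iff_ker δ hδ).1 h₀).finitePresentation
  rcases isEmpty_or_nonempty (Fin s) with hs | ⟨⟨i⟩⟩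
  · have : Subsingleton (LinearMap.ker ε) := hδ.subsingleton
    exact Module.Projective.of_equiv (LinearEquiv.ofBijective ε
      ⟨LinearMap.ker_eq_bot.1 ((Submodule.subsingleton_iff_eq_bot).1 this), hε⟩)
  · exfalso
    -- By minimality of the first cover, δ eᵢ has coordinates in 𝔪, which y kills.
    have hz : Pi.single i y ∈ LinearMap.ker δ := by
      have : Pi.single i y = y • (Pi.single i 1 : Fin s → R) := by
        rw [← Pi.single_smul, smul_eq_mul, mul_one]
      rw [LinearMap.mem_ker, this, map_smul]
      ext j
      simp only [Submodule.coe_smul, Pi.smul_apply, smul_eq_mul, Submodule.coe_zero,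
        Pi.zero_apply]
      rw [mul_comm]
      exact hy _ (hεm _ (δ _).2 j)
    obtain ⟨ι, φ, h⟩ := (maximalIdeal.isMaximal R).exists_retract_quotient
      (N := LinearMap.ker δ) (y := ⟨_, hz⟩) (fun a ha => by
        ext j
        by_cases hj : j = i
        · subst hj
          simpa using hy a ha
        · simp [hj]) (fun hmem => hy' (by
        let p : LinearMap.ker δ →ₗ[R] R := LinearMap.proj i ∘ₗ (LinearMap.ker δ).subtype
        -- By minimality of the second cover, ker δ has coordinates in 𝔪, so those of 𝔪 · ker δ lie
        -- in 𝔪².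
        have hle : (maximalIdeal R • (⊤ : Submodule R (LinearMap.ker δ))).map p ≤
            maximalIdeal R • maximalIdeal R := by
          rw [Submodule.map_smul'']
          refine Submodule.smul_mono le_rfl ?_
          rintro _ ⟨c, -, rfl⟩
          exact hδm _ c.2 i
        rw [pow_two]
        simpa [p] using hle (Submodule.mem_map_of_mem hmem)))
    exact hm (Ideal.fg_of_finitePresentation_quotient (.of_retract h))

end Local

/-! ### Infinite projective dimension and failure of the (2,d) property. -/

section Negative

variable {R : Type u} [CommRing R]

theorem ModuleCat.hasProjectiveDimensionLE_succ_iff_ker [Small.{v} R] {P E : Type v}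
    [AddCommGroup P] [Module R P]
    [AddCommGroup E] [Module R E] [Module.Projective R P] {g : P →ₗ[R] E}
    (hg : Function.Surjective g) (n : ℕ) :
    HasProjectiveDimensionLE (ModuleCat.of R E) (n + 1) ↔
      HasProjectiveDimensionLE (ModuleCat.of R (LinearMap.ker g)) n :=
  (LinearMap.shortExact_shortComplexKer hg).hasProjectiveDimensionLT_X₃_iff n
    ((IsProjective.iff_projective (R := R) P).1 ‹_›)

theorem ModuleCat.hasProjectiveDimensionLE_zero_iff [Small.{v} R] {E : Type v} [AddCommGroup E]
    [Module R E] :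
    HasProjectiveDimensionLE (ModuleCat.of R E) 0 ↔ Module.Projective R E :=
  (projective_iff_hasProjectiveDimensionLE_zero _).symm.trans
    (IsProjective.iff_projective (R := R) E).symm

theorem ModuleCat.hasProjectiveDimensionLE_of_retract {M N : Type v} [AddCommGroup M]
    [Module R M] [AddCommGroup N] [Module R N] {i : M →ₗ[R] N} {φ : N →ₗ[R] M}
    (h : φ ∘ₗ i = LinearMap.id) {n : ℕ} (hN : HasProjectiveDimensionLE (ModuleCat.of R N) n) :
    HasProjectiveDimensionLE (ModuleCat.of R M) n :=
  (Retract.mk (ModuleCat.ofHom i) (ModuleCat.ofHom φ) (by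
    rw [← ModuleCat.ofHom_comp, h]; rfl)).hasProjectiveDimensionLT _

/-- If the socle of `R` meets the maximal ideal `𝔪` outside `𝔪²`, then `R ⧸ 𝔪` has infinite
projective dimension unless `𝔪` is finitely generated. -/
theorem Ideal.IsMaximal.not_hasProjectiveDimensionLE_quotient {𝔪 : Ideal R} (h𝔪 : 𝔪.IsMaximal)
    (hfg : ¬ 𝔪.FG) {y : R} (hym : y ∈ 𝔪) (hy : ∀ a ∈ 𝔪, a * y = 0) (hy' : y ∉ 𝔪 ^ 2) (n : ℕ) :
    ¬ HasProjectiveDimensionLE (ModuleCat.of R (R ⧸ 𝔪)) n := by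
  induction n with
  | zero =>
    rw [ModuleCat.hasProjectiveDimensionLE_zero_iff]
    intro _
    exact hfg (fg_of_finitePresentation_quotient (Module.finitePresentation_of_projective _ _))
  | succ n ih =>
    rw [ModuleCat.hasProjectiveDimensionLE_succ_iff_ker 𝔪.mkQ_surjective]
    intro h
    rw [Submodule.ker_mkQ] at h
    -- The residue field is a summand of its own first syzygy 𝔪, so the bound drops by one.
    obtain ⟨i, φ, hiφ⟩ := h𝔪.exists_retract_quotient (N := 𝔪) (y := ⟨y, hym⟩)
      (fun a ha => Subtype.ext (hy a ha)) (fun hmem => hy' (by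
        have := Submodule.mem_map_of_mem (f := 𝔪.subtype) hmem
        rwa [Submodule.map_smul'', Submodule.map_top, Submodule.range_subtype, smul_eq_mul,
          ← pow_two] at this))
    exact ih (ModuleCat.hasProjectiveDimensionLE_of_retract hiφ h)

/-- The second syzygy of R/(x) is Ann(x), which contains y and has R/𝔪 as a summand. R is not
assumed local, so that the result also applies to products. -/
theorem not_isNDRing_two {𝔪 : Ideal R} (h𝔪 : 𝔪.IsMaximal) (hfg : ¬ 𝔪.FG) {x y : R}
    (hy : ∀ a ∈ 𝔪, a * y = 0) (hy' : y ∉ 𝔪 ^ 2) (hyx : y * x = 0)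
    (hx : (LinearMap.ker (LinearMap.toSpanSingleton R R x)).FG)
    (hxm : LinearMap.ker (LinearMap.toSpanSingleton R R x) ≤ 𝔪) (d : ℕ) :
    ¬ IsNDRing R 2 d := by
  intro h
  let X : Ideal R := LinearMap.ker (LinearMap.toSpanSingleton R R x)
  have hyX : y ∈ X := hyx
  let g : R →ₗ[R] LinearMap.ker (Ideal.span {x}).mkQ :=
    (LinearMap.toSpanSingleton R R x).codRestrict _ fun c => by
      rw [Submodule.ker_mkQ]
      exact Ideal.mul_mem_left _ _ (Ideal.mem_span_singleton_self x)
  have hg : Function.Surjective g := by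
    rintro ⟨z, hz⟩
    rw [Submodule.ker_mkQ] at hz
    obtain ⟨c, rfl⟩ := Ideal.mem_span_singleton'.1 hz
    exact ⟨c, rfl⟩
  have hker : LinearMap.ker g = X := LinearMap.ker_codRestrict _ _ _
  have hE : IsNPresented R 2 (R ⧸ Ideal.span {x}) := by
    rw [isNPresented_succ_iff_ker _ (Submodule.mkQ_surjective _), isNPresented_succ_iff_ker g hg,
      isNPresented_zero_iff, hker]
    exact Module.Finite.iff_fg.2 hx
  have hd := (projectiveDimension_le_iff _ _).1 (h (ModuleCat.of R (R ⧸ Ideal.span {x})) hE)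
  -- Weakening to d + 2 leaves the bound d after passing to the second syzygy.
  have hd' : HasProjectiveDimensionLE (ModuleCat.of R (R ⧸ Ideal.span {x})) (d + 2) :=
    hasProjectiveDimensionLT_of_ge _ (d + 1) _ (by omega)
  rw [ModuleCat.hasProjectiveDimensionLE_succ_iff_ker (Submodule.mkQ_surjective _),
    ModuleCat.hasProjectiveDimensionLE_succ_iff_ker hg, hker] at hd'
  obtain ⟨i, φ, hiφ⟩ := h𝔪.exists_retract_quotient (N := X) (y := ⟨y, hyX⟩)
    (fun a ha => Subtype.ext (hy a ha)) (fun hmem => hy' (by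
      have := Submodule.mem_map_of_mem (f := X.subtype) hmem
      rw [Submodule.map_smul'', Submodule.map_top, Submodule.range_subtype, smul_eq_mul] at this
      rw [pow_two]
      exact Ideal.mul_mono_right hxm this))
  exact h𝔪.not_hasProjectiveDimensionLE_quotient hfg (hxm hyX) hy hy' d
    (ModuleCat.hasProjectiveDimensionLE_of_retract hiφ hd')

end Negative

/-! ### Projective dimension along a surjection S → T with T projective over S. -/

section RestrictScalars

theorem Module.Projective.restrictScalars (S : Type*) {T : Type*} [CommRing S] [CommRing T]
    [Algebra S T] [Module.Projective S T] (N : Type*) [AddCommGroup N] [Module T N]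
    [Module S N] [IsScalarTower S T N] [Module.Projective T N] : Module.Projective S N := by
  obtain ⟨s, hs⟩ := Module.projective_def'.1 (‹_› : Module.Projective T N)
  classical
  have : Module.Projective S (N →₀ T) := .of_equiv (finsuppLequivDFinsupp S).symm
  exact Module.Projective.of_split (s.restrictScalars S)
    ((Finsupp.linearCombination T id).restrictScalars S)
    (LinearMap.ext fun n => LinearMap.congr_fun hs n)

/-- Conversely to the previous lemma, an S-linear splitting of a free T-cover is T-linear because S
→ T is onto. -/
theorem Module.projective_iff_restrictScalars {S T : Type*} [CommRing S] [CommRing T]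
    [Algebra S T] (hST : Function.Surjective (algebraMap S T)) [Module.Projective S T]
    {N : Type*} [AddCommGroup N] [Module T N] [Module S N] [IsScalarTower S T N] :
    Module.Projective T N ↔ Module.Projective S N := by
  refine ⟨fun _ => Module.Projective.restrictScalars S (T := T) N, fun _ => ?_⟩
  obtain ⟨s, hs⟩ := ((Finsupp.linearCombination T (id : N → N)).restrictScalars S
    ).exists_rightInverse_of_surjective (LinearMap.range_eq_top.2
      (Finsupp.linearCombination_id_surjective T N))
  exact Module.Projective.of_split (LinearMap.extendScalarsOfSurjective hST s)
    (Finsupp.linearCombination T id) (LinearMap.ext fun n => LinearMap.congr_fun hs n)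

theorem ModuleCat.hasProjectiveDimensionLE_iff_restrictScalars {S : Type u} {T : Type w}
    [CommRing S] [CommRing T] [Small.{v} S] [Small.{v} T] [Algebra S T]
    (hST : Function.Surjective (algebraMap S T)) [Module.Projective S T] {N : Type v}
    [AddCommGroup N] [Module T N] [Module S N] [IsScalarTower S T N] (n : ℕ) :
    HasProjectiveDimensionLE (ModuleCat.of T N) n ↔
      HasProjectiveDimensionLE (ModuleCat.of S N) n := by
  induction n generalizing N with
  | zero =>
    rw [hasProjectiveDimensionLE_zero_iff, hasProjectiveDimensionLE_zero_iff,
      Module.projective_iff_restrictScalars hST]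
  | succ n ih =>
    -- A projective T-cover stays projective over S, so one kernel serves as syzygy over both rings.
    obtain ⟨F, _, _, _, g, hg⟩ : ∃ (F : Type v) (_ : AddCommGroup F) (_ : Module T F)
        (_ : Module.Projective T F) (g : F →ₗ[T] N), Function.Surjective g := by
      let b : Module.Basis N T (N →₀ Shrink.{v} T) :=
        ⟨Finsupp.mapRange.linearEquiv (Shrink.linearEquiv.{v} T T)⟩
      exact ⟨_, _, _, .of_basis b, b.constr ℕ id, fun m => ⟨b m, by simp⟩⟩
    let _ : Module S F := Module.compHom F (algebraMap S T)
    have : IsScalarTower S T F := .of_algebraMap_smul fun _ _ => rfl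
    have : Module.Projective S F := .restrictScalars (T := T) S F
    rw [hasProjectiveDimensionLE_succ_iff_ker hg, ih,
      hasProjectiveDimensionLE_succ_iff_ker (g := g.restrictScalars S) hg]
    exact Iff.rfl

end RestrictScalars

/-! ### Auslander's theorem on global dimension. -/

section Auslander

open Abelian

variable {R : Type u} [CommRing R]

/-- Baer's criterion: the obstruction to extending I → N to R lies in Ext¹(R/I, N). -/
theorem ModuleCat.injective_of_ext_quotient_eq_zero {N : ModuleCat.{u} R}
    (h : ∀ (I : Ideal R) (e : Ext (ModuleCat.of R (R ⧸ I)) N 1), e = 0) : Injective N := by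
  rw [← Module.injective_iff_injective_object, ← Module.Baer.iff_injective]
  intro I g
  have hS := LinearMap.shortExact_shortComplexKer (f := I.mkQ) I.mkQ_surjective
  let e : LinearMap.ker I.mkQ ≃ₗ[R] I := LinearEquiv.ofEq _ _ I.ker_mkQ
  obtain ⟨x, hx⟩ := Ext.contravariant_sequence_exact₁ hS N
    (Ext.mk₀ (ModuleCat.ofHom (g ∘ₗ e.toLinearMap))) (add_zero 1) (h I _)
  refine ⟨(Ext.homEquiv₀ x).hom, fun r hr => ?_⟩
  rw [← Ext.mk₀_homEquiv₀_apply x, Ext.mk₀_comp_mk₀] at hx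
  have := Ext.homEquiv₀.symm.injective hx
  exact LinearMap.congr_fun (congrArg ModuleCat.Hom.hom this) ⟨r, by rwa [I.ker_mkQ]⟩

theorem ModuleCat.hasInjectiveDimensionLT_of_ext_quotient_eq_zero {N : ModuleCat.{u} R} {n : ℕ}
    (h : ∀ (I : Ideal R) (e : Ext (ModuleCat.of R (R ⧸ I)) N (n + 1)), e = 0) :
    HasInjectiveDimensionLT N (n + 1) := by
  induction n generalizing N with
  | zero =>
    have := injective_of_ext_quotient_eq_zero h
    infer_instance
  | succ n ih =>
    -- Dimension shifting: embed N in an injective and pass to the cokernel.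
    obtain ⟨I, _, f, _⟩ := EnoughInjectives.presentation N
    let T := ShortComplex.mk f (Limits.cokernel.π f) (Limits.cokernel.condition f)
    have hT : T.ShortExact := { exact := ShortComplex.exact_cokernel f }
    refine (hT.hasInjectiveDimensionLT_X₃_iff n ‹_›).1 (ih fun J e => ?_)
    obtain ⟨x, rfl⟩ := Ext.covariant_sequence_exact₃ _ hT e rfl (h J _)
    rw [Ext.eq_zero_of_injective x, Ext.zero_comp]

/-- Auslander: projective dimensions of arbitrary modules are bounded by those of the cyclic
modules. -/
theorem ModuleCat.hasProjectiveDimensionLT_of_forall_quotient {n : ℕ}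
    (h : ∀ I : Ideal R, HasProjectiveDimensionLT (ModuleCat.of R (R ⧸ I)) (n + 1))
    (M : ModuleCat.{u} R) : HasProjectiveDimensionLT M (n + 1) :=
  HasProjectiveDimensionLT.mk fun i hi N e => by
    have : HasInjectiveDimensionLT N (n + 1) :=
      hasInjectiveDimensionLT_of_ext_quotient_eq_zero fun I e =>
        e.eq_zero_of_hasProjectiveDimensionLT (n + 1) le_rfl
    exact e.eq_zero_of_hasInjectiveDimensionLT (n + 1) hi

theorem exists_ideal_not_hasProjectiveDimensionLE {d : ℕ} (hd : globalDim R = (d + 1 : ℕ)) :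
    ∃ I : Ideal R, ¬ HasProjectiveDimensionLE (ModuleCat.of R (R ⧸ I)) d := by
  by_contra! h
  have : globalDim R ≤ d := iSup_le fun E =>
    (projectiveDimension_le_iff E d).2 (ModuleCat.hasProjectiveDimensionLT_of_forall_quotient h E)
  rw [hd] at this
  norm_cast at this
  omega

end Auslander

open TensorProduct

/-! ### n-presentedness under flat base change and restriction of scalars. -/

section BaseChange

theorem IsNPresented.baseChange_aux {S : Type u} {R : Type w} [CommRing S] [CommRing R]
    [Algebra S R] [Module.Flat S R] {n : ℕ} {E : Type u} [AddCommGroup E] [Module S E]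
    (h : IsNPresented S n E) : IsNPresented R n (R ⊗[S] E) := by
  induction n generalizing E with
  | zero =>
    rw [isNPresented_zero_iff] at h ⊢
    infer_instance
  | succ n ih =>
    obtain ⟨r, ε, hε, h⟩ := isNPresented_succ_iff.1 h
    have hg : Function.Surjective (ε.baseChange R) := LinearMap.lTensor_surjective R hε
    rw [isNPresented_succ_iff_ker _ hg]
    exact (ih h).of_linearEquiv (Function.Exact.equivKer
      (i := (LinearMap.ker ε).subtype.baseChange R)
      (lTensor_exact R (LinearMap.exact_subtype_ker_map ε) hε)
      (Module.Flat.lTensor_preserves_injective_linearMap _ Subtype.val_injective))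

theorem IsNPresented.baseChange {S : Type u} {R : Type w} [CommRing S] [CommRing R]
    [Algebra S R] [Module.Flat S R] {n : ℕ} {E : Type v} [AddCommGroup E] [Module S E]
    (h : IsNPresented S n E) : IsNPresented R n (R ⊗[S] E) := by
  have := h.finite
  have : Small.{u} E := Module.Finite.small.{u} S E
  exact ((h.of_linearEquiv (Shrink.linearEquiv.{u} S E).symm).baseChange_aux (R := R)
    ).of_linearEquiv ((Shrink.linearEquiv.{u} S E).baseChange S R _ _)

/-- Syzygies over T stay finite, and by Schanuel the modules Tʳ, finitely generated projective over
S, may replace free S-modules. -/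
theorem IsNPresented.of_finite_of_isNoetherianRing {S : Type u} {T : Type w} [CommRing S]
    [CommRing T] [IsNoetherianRing T] [Algebra S T] [Module.Finite S T] [Module.Projective S T]
    (n : ℕ) (N : Type w) [AddCommGroup N] [Module T N] [Module S N] [IsScalarTower S T N]
    [Module.Finite T N] : IsNPresented S n N := by
  induction n generalizing N with
  | zero => exact isNPresented_zero_iff.2 (Module.Finite.trans T N)
  | succ n ih =>
    obtain ⟨r, g, hg⟩ := Module.Finite.exists_fin' T N
    have : Module.Projective S (Fin r → T) := .restrictScalars S (T := T) _
    rw [isNPresented_succ_iff_ker (g.restrictScalars S) hg]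
    exact ih (LinearMap.ker g)

end BaseChange

/-! ### Transfer to product rings. -/

section Product

variable {R : Type u} {T : Type w} {S : Type (max u w)} [CommRing R] [CommRing T] [CommRing S]
  [Algebra S R] [Algebra S T]

theorem ModuleCat.hasProjectiveDimensionLE_prod {R : Type u} [CommRing R] {M N : Type v}
    [AddCommGroup M] [Module R M]
    [AddCommGroup N] [Module R N] {n : ℕ} (hM : HasProjectiveDimensionLE (ModuleCat.of R M) n)
    (hN : HasProjectiveDimensionLE (ModuleCat.of R N) n) :
    HasProjectiveDimensionLE (ModuleCat.of R (M × N)) n :=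
  hasProjectiveDimensionLT_of_iso (ModuleCat.biprodIsoProd (.of R M) (.of R N)) _

/-- E is the sum of R ⊗ E, which is projective by flat base change of the presentation, and T ⊗ E,
bounded by the global dimension of T. -/
theorem isNDRing_of_linearEquiv_prod (e : S ≃ₗ[S] R × T)
    (hT : Function.Surjective (algebraMap S T)) {n d : ℕ}
    (hR : ∀ (E : Type (max u w)) [AddCommGroup E] [Module R E],
      IsNPresented R n E → Module.Projective R E)
    (hd : globalDim T ≤ d) : IsNDRing S n d := by
  intro E hE
  have hSR : Module.Projective S R :=
    .of_split (e.symm.toLinearMap ∘ₗ LinearMap.inl S R T)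
      (LinearMap.fst S R T ∘ₗ e.toLinearMap) (by ext; simp)
  have hST : Module.Projective S T :=
    .of_split (e.symm.toLinearMap ∘ₗ LinearMap.inr S R T)
      (LinearMap.snd S R T ∘ₗ e.toLinearMap) (by ext; simp)
  have := hE.finite
  have hX : Module.Projective R (R ⊗[S] E) := hR _ hE.baseChange
  have hX' : Module.Projective S (R ⊗[S] E) := .restrictScalars S (T := R) _
  have hX'' : HasProjectiveDimensionLE (ModuleCat.of S (R ⊗[S] E)) d :=
    have := ModuleCat.hasProjectiveDimensionLE_zero_iff.2 hX'
    hasProjectiveDimensionLT_of_ge _ 1 _ (by omega)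
  -- `globalDim T` only sees modules in the universe of T, so the finite module T ⊗ E is shrunk into
  -- it.
  have : Small.{w} (T ⊗[S] E) := Module.Finite.small.{w} T _
  have : Small.{max u w} T := small_lift.{w, u, w} T
  have hY₀ : HasProjectiveDimensionLE (ModuleCat.of T (Shrink.{w} (T ⊗[S] E))) d :=
    (projectiveDimension_le_iff _ _).1 ((le_iSup _ _).trans hd)
  have hY : HasProjectiveDimensionLE (ModuleCat.of T (T ⊗[S] E)) d :=
    ModuleCat.hasProjectiveDimensionLE_of_linearEquiv
      (M := ModuleCat.of T (Shrink.{w} (T ⊗[S] E))) (Shrink.linearEquiv.{w} T _) d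
  have hY' := (ModuleCat.hasProjectiveDimensionLE_iff_restrictScalars hT d).1 hY
  rw [projectiveDimension_le_iff]
  have := ModuleCat.hasProjectiveDimensionLE_prod hX'' hY'
  let f : E ≃ₗ[S] (R ⊗[S] E) × (T ⊗[S] E) :=
    (TensorProduct.lid S E).symm.trans
      ((TensorProduct.congr e (LinearEquiv.refl S E)).trans (TensorProduct.prodLeft S S R T E))
  exact hasProjectiveDimensionLT_of_iso f.symm.toModuleIso _

theorem not_isNDRing_of_globalDim [IsNoetherianRing T] [Module.Projective S T]
    (hT : Function.Surjective (algebraMap S T)) {d : ℕ} (hd : globalDim T = (d + 1 : ℕ)) (n : ℕ) :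
    ¬ IsNDRing S n d := by
  intro h
  obtain ⟨I, hI⟩ := exists_ideal_not_hasProjectiveDimensionLE hd
  have : Module.Finite S T := .of_surjective (Algebra.linearMap S T) hT
  have : Small.{max u w} T := small_lift.{w, u, w} T
  have hE : IsNPresented S n (ULift.{u} (T ⧸ I)) :=
    (IsNPresented.of_finite_of_isNoetherianRing (T := T) n (T ⧸ I)).of_linearEquiv
      ULift.moduleEquiv.symm
  have h₁ := (projectiveDimension_le_iff _ _).1 (h (ModuleCat.of S (ULift.{u} (T ⧸ I))) hE)
  have h₂ : HasProjectiveDimensionLE (ModuleCat.of T (ULift.{u} (T ⧸ I))) d :=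
    (ModuleCat.hasProjectiveDimensionLE_iff_restrictScalars hT d).2 h₁
  exact hI (ModuleCat.hasProjectiveDimensionLE_of_linearEquiv
    (M := ModuleCat.of T (ULift.{u} (T ⧸ I))) (N := ModuleCat.of T (T ⧸ I)) ULift.moduleEquiv d)

end Product

/-- Use the maximal ideal 𝔪 × T with (y, 0) and (x, 1); the coordinate 1 makes the annihilator
Ann(x) × 0. -/
theorem not_isNDRing_two_prod {R : Type u} [CommRing R] (T : Type w) [CommRing T]
    {𝔪 : Ideal R} (h𝔪 : 𝔪.IsMaximal) (hfg : ¬ 𝔪.FG) {x y : R}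
    (hy : ∀ a ∈ 𝔪, a * y = 0) (hy' : y ∉ 𝔪 ^ 2) (hyx : y * x = 0)
    (hx : (LinearMap.ker (LinearMap.toSpanSingleton R R x)).FG)
    (hxm : LinearMap.ker (LinearMap.toSpanSingleton R R x) ≤ 𝔪) (d : ℕ) :
    ¬ IsNDRing (R × T) 2 d := by
  have hsurj : Function.Surjective (RingHom.fst R T) := Prod.fst_surjective
  refine not_isNDRing_two (𝔪 := 𝔪.comap (RingHom.fst R T)) (x := (x, 1)) (y := (y, 0))
    (Ideal.comap_isMaximal_of_surjective _ hsurj) ?_ ?_ ?_ ?_ ?_ ?_ d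
  · intro h
    apply hfg
    rw [← Ideal.map_comap_of_surjective _ hsurj 𝔪]
    exact h.map _
  · intro a ha
    exact Prod.ext (hy _ ha) (mul_zero _)
  · intro h
    exact hy' (Ideal.le_comap_pow (RingHom.fst R T) 2 h)
  · exact Prod.ext hyx (zero_mul _)
  · obtain ⟨s, hs, hsX⟩ := Submodule.fg_def.1 hx
    refine Submodule.fg_def.2 ⟨(fun g => (g, (0 : T))) '' s, hs.image _, le_antisymm ?_ ?_⟩
    · rw [Submodule.span_le]
      rintro _ ⟨g, hg, rfl⟩
      have : g * x = 0 := (hsX.le (Submodule.subset_span hg) :)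
      exact Prod.ext this (zero_mul _)
    · rintro ⟨a, b⟩ hab
      obtain ⟨ha₀, hb⟩ := Prod.mk.inj (LinearMap.mem_ker.1 hab :)
      obtain rfl : b = 0 := by simpa using hb
      have ha : a ∈ Submodule.span R s := hsX.ge ha₀
      clear hab hb ha₀
      induction ha using Submodule.span_induction with
      | mem g hg => exact Submodule.subset_span ⟨g, hg, rfl⟩
      | zero => exact zero_mem _
      | add g g' _ _ hg hg' => simpa using add_mem hg hg'
      | smul c g _ hg => simpa using Submodule.smul_mem _ ((c, 0) : R × T) hg
  · rintro ⟨a, b⟩ hab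
    exact hxm (Prod.mk.inj (LinearMap.mem_ker.1 hab :)).1

section ProductRing

variable (R : Type u) (T : Type w) [CommRing R] [CommRing T]

theorem isNDRing_prod {n d : ℕ}
    (hR : ∀ (E : Type (max u w)) [AddCommGroup E] [Module R E],
      IsNPresented R n E → Module.Projective R E)
    (hd : globalDim T ≤ d) : IsNDRing (R × T) n d := by
  let _ : Algebra (R × T) R := (RingHom.fst R T).toAlgebra
  let _ : Algebra (R × T) T := (RingHom.snd R T).toAlgebra
  exact isNDRing_of_linearEquiv_prod (R := R) (T := T)
    { AddEquiv.refl _ with map_smul' := fun _ _ => rfl } Prod.snd_surjective hR hd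

theorem not_isNDRing_prod_of_globalDim [IsNoetherianRing T] {d : ℕ}
    (hd : globalDim T = (d + 1 : ℕ)) (n : ℕ) : ¬ IsNDRing (R × T) n d := by
  let _ : Algebra (R × T) T := (RingHom.snd R T).toAlgebra
  have : Module.Projective (R × T) T :=
    .of_split (M := R × T)
      { AddMonoidHom.inr R T with map_smul' := fun s t => Prod.ext (mul_zero s.1).symm rfl }
      (Algebra.linearMap (R × T) T) (LinearMap.ext fun _ => rfl)
  exact not_isNDRing_of_globalDim.{u, w} (S := R × T) (T := T) Prod.snd_surjective hd n

end ProductRing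

/-! ### The amalgamation: its maximal ideal, y = (0, j) and x = (a, f a). -/

namespace amalgamation

variable {A : Type u} {B : Type v} [CommRing A] [CommRing B] {f : A →+* B} {J : Ideal B}

variable (f) in
/-- The element `(a, f a + j)` of the amalgamation. -/
def mk (a : A) {j : B} (hj : j ∈ J) : amalgamation f J := ⟨(a, f a + j), a, j, hj, rfl⟩

theorem exists_eq_mk (z : amalgamation f J) : ∃ (a : A) (j : B) (hj : j ∈ J), z = mk f a hj := by
  obtain ⟨_, a, j, hj, rfl⟩ := z
  exact ⟨a, j, hj, rfl⟩

variable (f J) in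
/-- The first projection of the amalgamation. -/
def fst : amalgamation f J →+* A := (RingHom.fst A B).comp (amalgamation f J).subtype

theorem fst_surjective : Function.Surjective (fst f J) := fun a => ⟨mk f a J.zero_mem, rfl⟩

theorem mul_eq_zero_of_sq_eq_bot (hJJ : J ^ 2 = ⊥) {j k : B} (hj : j ∈ J) (hk : k ∈ J) : j * k = 0 := by
  have := Ideal.mul_mem_mul hj hk
  rwa [← pow_two, hJJ] at this

theorem isLocalHom_fst (hJJ : J ^ 2 = ⊥) : IsLocalHom (fst f J) := by
  refine ⟨fun z hz => ?_⟩
  obtain ⟨a, j, hj, rfl⟩ := exists_eq_mk z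
  obtain ⟨b, hb⟩ := isUnit_iff_exists_inv.1 (show IsUnit a from hz)
  -- With b = a⁻¹ and j² = 0, the inverse of f a + j is f b − (f b)² j.
  refine isUnit_iff_exists_inv.2 ⟨mk f b (J.neg_mem (J.mul_mem_left (f b * f b) hj)), ?_⟩
  refine Subtype.ext (Prod.ext hb ?_)
  have h₁ : f a * f b = 1 := by rw [← map_mul, hb, map_one]
  have h₂ := mul_eq_zero_of_sq_eq_bot hJJ hj hj
  change (f a + j) * (f b + -(f b * f b * j)) = 1
  linear_combination (1 - f b * j) * h₁ - f b * f b * h₂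

open IsLocalRing

variable [IsLocalRing A]

/-- In (f a + j)(f b + k) with a, b ∈ M every term other than f(ab) vanishes. This keeps (0, j) with
j ≠ 0 out of 𝔪². -/
theorem snd_eq_of_mem_sq_comap_fst (hJJ : J ^ 2 = ⊥)
    (hMJ : ∀ m ∈ maximalIdeal A, ∀ j ∈ J, f m * j = 0) {z : amalgamation f J}
    (hz : z ∈ (maximalIdeal A).comap (fst f J) ^ 2) : z.1.2 = f z.1.1 := by
  rw [pow_two] at hz
  refine Submodule.mul_induction_on (C := fun z => z.1.2 = f z.1.1) hz
    (fun p hp q hq => ?_) fun p q hp hq => ?_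
  · obtain ⟨a, j, hj, rfl⟩ := exists_eq_mk p
    obtain ⟨b, k, hk, rfl⟩ := exists_eq_mk q
    have h₁ := hMJ a hp k hk
    have h₂ := hMJ b hq j hj
    have h₃ := mul_eq_zero_of_sq_eq_bot hJJ hj hk
    change (f a + j) * (f b + k) = f (a * b)
    rw [map_mul]
    linear_combination h₁ + h₂ + h₃
  · change p.1.2 + q.1.2 = f (p.1.1 + q.1.1)
    rw [map_add, hp, hq]

theorem mul_mk_zero_eq_zero (hJJ : J ^ 2 = ⊥)
    (hMJ : ∀ m ∈ maximalIdeal A, ∀ j ∈ J, f m * j = 0) {j : B} (hj : j ∈ J)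
    {z : amalgamation f J} (hz : z ∈ (maximalIdeal A).comap (fst f J)) : z * mk f 0 hj = 0 := by
  obtain ⟨a, k, hk, rfl⟩ := exists_eq_mk z
  refine Subtype.ext (Prod.ext (mul_zero a) ?_)
  change (f a + k) * (f 0 + j) = 0
  rw [map_zero, zero_add, add_mul, hMJ a hz j hj, mul_eq_zero_of_sq_eq_bot hJJ hk hj, add_zero]

theorem not_fg_comap_fst (hM : ¬ (maximalIdeal A).FG) :
    ¬ ((maximalIdeal A).comap (fst f J)).FG := fun h => by
  apply hM
  rw [← Ideal.map_comap_of_surjective _ (fst_surjective (f := f) (J := J)) (maximalIdeal A)]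
  exact h.map _

theorem mem_ker_toSpanSingleton_mk_iff [IsDomain A]
    (hMJ : ∀ m ∈ maximalIdeal A, ∀ j ∈ J, f m * j = 0) {a : A} (ha : a ∈ maximalIdeal A)
    (ha₀ : a ≠ 0) {z : amalgamation f J} :
    z ∈ LinearMap.ker (LinearMap.toSpanSingleton (amalgamation f J) _ (mk f a J.zero_mem)) ↔
      z.1.1 = 0 := by
  obtain ⟨b, k, hk, rfl⟩ := exists_eq_mk z
  rw [LinearMap.mem_ker, LinearMap.toSpanSingleton_apply, smul_eq_mul]
  constructor
  · intro h
    exact (mul_eq_zero.1 (congrArg (fun z => z.1.1) h : b * a = 0)).resolve_right ha₀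
  · rintro (rfl : b = 0)
    refine Subtype.ext (Prod.ext (zero_mul a) ?_)
    change (f 0 + k) * (f a + 0) = 0
    rw [map_zero, zero_add, add_zero, mul_comm, hMJ a ha k hk]

/-- The annihilator is 0 × J, on which the amalgamation acts through its second projection onto f(A)
+ J, so generators of J over f(A) + J suffice. -/
theorem fg_ker_toSpanSingleton_mk [IsDomain A] (hJ : (idealInRangeAdd f J).FG)
    (hMJ : ∀ m ∈ maximalIdeal A, ∀ j ∈ J, f m * j = 0) {a : A} (ha : a ∈ maximalIdeal A)
    (ha₀ : a ≠ 0) :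
    (LinearMap.ker
      (LinearMap.toSpanSingleton (amalgamation f J) _ (mk f a J.zero_mem))).FG := by
  obtain ⟨s, hs, hspan⟩ := Submodule.fg_def.1 hJ
  have hsJ (t : s) : t.1.1 ∈ J := (hspan.le (Submodule.subset_span t.2) :)
  have := hs.to_subtype
  refine Submodule.fg_def.2 ⟨Set.range fun t : s => mk f 0 (hsJ t), Set.finite_range _,
    le_antisymm ?_ fun z hz => ?_⟩
  · rw [Submodule.span_le]
    rintro _ ⟨t, rfl⟩
    exact (mem_ker_toSpanSingleton_mk_iff hMJ ha ha₀).2 rfl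
  · rw [mem_ker_toSpanSingleton_mk_iff hMJ ha ha₀] at hz
    obtain ⟨b, k, hk, rfl⟩ := exists_eq_mk z
    obtain rfl : b = 0 := hz
    have hmem : (⟨k, 0, k, hk, by simp⟩ : rangeAddIdeal f J) ∈
        Submodule.span (rangeAddIdeal f J) s := hspan.ge hk
    have key (c : rangeAddIdeal f J) (hc : c ∈ Submodule.span (rangeAddIdeal f J) s) :
        ∃ hcJ : c.1 ∈ J, mk f 0 hcJ ∈
          Submodule.span (amalgamation f J) (Set.range fun t : s => mk f 0 (hsJ t)) := by
      induction hc using Submodule.span_induction with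
      | mem t ht => exact ⟨hsJ ⟨t, ht⟩, Submodule.subset_span ⟨⟨t, ht⟩, rfl⟩⟩
      | zero =>
        refine ⟨J.zero_mem, ?_⟩
        convert Submodule.zero_mem _ using 1
        exact Subtype.ext (Prod.ext rfl (by simp [mk]))
      | add p q _ _ hp hq =>
        obtain ⟨hpJ, hp⟩ := hp
        obtain ⟨hqJ, hq⟩ := hq
        refine ⟨J.add_mem hpJ hqJ, ?_⟩
        convert add_mem hp hq using 1
        exact Subtype.ext (Prod.ext (add_zero _).symm (by simp [mk]))
      | smul c p _ hp =>
        obtain ⟨hpJ, hp⟩ := hp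
        refine ⟨J.mul_mem_left c.1 hpJ, ?_⟩
        obtain ⟨_, a, j, hj, rfl⟩ := c
        convert Submodule.smul_mem _ (mk f a hj) hp using 1
        exact Subtype.ext (Prod.ext (mul_zero _).symm (by simp [mk]))
    exact (key _ hmem).2

end amalgamation
theorem corollary3p6 {A : Type u} {B : Type v} [CommRing A] [IsDomain A] [IsLocalRing A]
    [CommRing B] (f : A →+* B) (J : Ideal B)
    (hM : ¬ (IsLocalRing.maximalIdeal A).FG)
    (hJ_ne_bot : J ≠ ⊥) (hJ_ne_top : J ≠ ⊤)
    (hJ_fg : (idealInRangeAdd f J).FG)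
    (hMJ : ∀ m ∈ IsLocalRing.maximalIdeal A, ∀ j ∈ J, f m * j = 0)
    (hJJ : J ^ 2 = ⊥) :
    (IsNDRing (amalgamation f J) 3 0 ∧ ¬ IsNDRing (amalgamation f J) 2 0) ∧
    ∀ (d : ℕ) (A₂ : Type w) [CommRing A₂] [IsNoetherianRing A₂],
      globalDim A₂ = (d : WithBot ℕ∞) →
        IsNDRing (amalgamation f J × A₂) 3 d ∧
        ¬ IsNDRing (amalgamation f J × A₂) 2 d ∧
        (1 ≤ d → ¬ IsNDRing (amalgamation f J × A₂) 3 (d - 1)) := by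
  have := amalgamation.isLocalHom_fst (f := f) hJJ
  have := (amalgamation.fst f J).domain_isLocalRing
  let 𝔪 := (IsLocalRing.maximalIdeal A).comap (amalgamation.fst f J)
  have h𝔪 : 𝔪 = IsLocalRing.maximalIdeal _ := IsLocalRing.maximalIdeal_comap _
  have h𝔪' : 𝔪.IsMaximal := h𝔪 ▸ IsLocalRing.maximalIdeal.isMaximal _
  have hfg : ¬ 𝔪.FG := amalgamation.not_fg_comap_fst hM
  obtain ⟨j, hj, hj₀⟩ := Submodule.exists_mem_ne_zero_of_ne_bot hJ_ne_bot
  -- M ≠ 0 because the zero ideal is finitely generated.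
  obtain ⟨a, ha, ha₀⟩ := Submodule.exists_mem_ne_zero_of_ne_bot
    (p := IsLocalRing.maximalIdeal A) (fun h => hM (h ▸ Submodule.fg_bot))
  let y : amalgamation f J := amalgamation.mk f 0 hj
  have hy (z) (hz : z ∈ 𝔪) : z * y = 0 := amalgamation.mul_mk_zero_eq_zero hJJ hMJ hj hz
  have hy' : y ∉ 𝔪 ^ 2 := fun h => hj₀ <| by
    simpa [y, amalgamation.mk] using amalgamation.snd_eq_of_mem_sq_comap_fst hJJ hMJ h
  let x : amalgamation f J := amalgamation.mk f a J.zero_mem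
  have hyx : y * x = 0 := (mul_comm y x).trans (hy x ha)
  have hx := amalgamation.fg_ker_toSpanSingleton_mk hJ_fg hMJ ha ha₀
  have hxm : LinearMap.ker (LinearMap.toSpanSingleton (amalgamation f J) _ x) ≤ 𝔪 := fun z hz => by
    have hz : amalgamation.fst f J z = 0 :=
      (amalgamation.mem_ker_toSpanSingleton_mk_iff hMJ ha ha₀).1 hz
    rw [Ideal.mem_comap, hz]
    exact zero_mem _
  have hproj {E : Type max u v w} [AddCommGroup E] [Module (amalgamation f J) E]
      (hE : IsNPresented (amalgamation f J) 3 E) : Module.Projective (amalgamation f J) E :=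
    IsLocalRing.projective_of_isNPresented_three (h𝔪 ▸ hfg) (h𝔪 ▸ hy) (h𝔪 ▸ hy') hE
  refine ⟨⟨fun E hE => ?_, not_isNDRing_two h𝔪' hfg hy hy' hyx hx hxm 0⟩,
    fun d A₂ _ _ hd => ⟨isNDRing_prod _ _ (fun E _ _ hE => hproj hE) hd.le,
      not_isNDRing_two_prod A₂ h𝔪' hfg hy hy' hyx hx hxm d, fun h => ?_⟩⟩
  · exact (projectiveDimension_le_iff _ _).2 (ModuleCat.hasProjectiveDimensionLE_zero_iff.2
      (IsLocalRing.projective_of_isNPresented_three (h𝔪 ▸ hfg) (h𝔪 ▸ hy) (h𝔪 ▸ hy') hE))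
  · obtain ⟨d, rfl⟩ := Nat.exists_eq_add_of_le' h
    exact not_isNDRing_prod_of_globalDim _ _ hd 3
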